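/- **Theorem (Compactness of Ricci flows: Extension 2).** Manifolds are smooth, without boundary, Hausdorff and second countable. Let $-\infty\le a<0<b\le\infty$ and let $(\mathcal M_i,g_i(t))$, $t\in(a,b)$, $i\in\mathbb N$, be a sequence of complete smooth Ricci flows ($\partial_t g_i=-2\,\mathrm{Ric}(g_i)$, with $g_i(t)$ complete for every $t\in(a,b)$) on $n$-dimensional manifolds, with points $p_i\in\mathcal M_i$. Suppose that (i)$'$ there is $M<\infty$ such that for every $r>0$ there is $K=K(r)\in\mathbb N$ such that for all $t\in(a,b)$ and all $i\ge K$ $$\sup_{B_{g_i(0)}(p_i,r)}\big|\mathrm{Rm}(g_i(t))\big|_{g_i(t)}\le M ;$$ (ii) $\inf_i \mathrm{inj}(\mathcal M_i,g_i(0),p_i)>0$. Let $(\mathcal M,g(t),p)$, $t\in(a,b)$, be a limit flow of this sequence, that is: $\mathcal M$ is a connected $n$-dimensional manifold, $g(t)$ is a smooth Ricci flow on $\mathcal M$ for $t\in(a,b)$, $p\in\mathcal M$, $(\mathcal M,g(0))$ is complete, and after passing to a subsequence in $i$ we have $(\mathcal M_i,g_i(t),p_i)\to(\mathcal M,g(t),p)$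 in the sense of Hamilton–Cheeger–Gromov: there are compact sets $\Omega_i\subset\mathcal M$ exhausting $\mathcal M$ (every compact subset of $\mathcal M$ lies in $\Omega_i$ for all large $i$) with $p\in\mathrm{int}(\Omega_i)$, and smooth maps $\phi_i:\Omega_i\to\mathcal M_i$, diffeomorphic onto their images, with $\phi_i(p)=p_i$, such that $\phi_i^*g_i(t)\to g(t)$ smoothly locally on $\mathcal M\times(a,b)$. Then $(\mathcal M,g(t))$ is complete for every $t\in(a,b)$. -/

import Mathlib

open Set Filter Topology
open scoped Manifold ContDiff Bundle ENNReal

noncomputable section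

namespace RicciLimit

/-! ### Riemannian metrics on smooth manifolds

Smooth `n`-manifolds (without boundary) are modelled on `EuclideanSpace ℝ (Fin n)` by `𝓡 n`. -/

/-- The model space `ℝⁿ`. -/
abbrev Eu (n : ℕ) : Type := EuclideanSpace ℝ (Fin n)

/-- A smooth Riemannian metric on the smooth manifold `M` of dimension `n`. -/
abbrev Metr (n : ℕ) (M : Type*) [TopologicalSpace M] [ChartedSpace (Eu n) M]
    [IsManifold (𝓡 n) ∞ M] :=
  Bundle.ContMDiffRiemannianMetric (𝓡 n) ∞ (Eu n) (fun x : M => TangentSpace (𝓡 n) x)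

/-- The `i`-th standard basis vector of `ℝⁿ`. -/
def bv {n : ℕ} (i : Fin n) : Eu n := EuclideanSpace.single i 1

/-- The `i`-th coordinate functional on `ℝⁿ`. -/
def bco {n : ℕ} (i : Fin n) : Eu n →L[ℝ] ℝ := EuclideanSpace.proj i

section LocalFormulas

/-! ### Local formulas on open subsets of `ℝⁿ`

Here `G` is a field of bilinear forms on (an open subset of) `ℝⁿ`, the metric in coordinates:
`G y u v = g_{jk}(y) u^j v^k`. -/

variable {n : ℕ} (G : Eu n → Eu n →L[ℝ] Eu n →L[ℝ] ℝ)

/-- The Christoffel symbols, as a vector valued bilinear map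
`Γ y u v = Γ^l_{jk}(y) u^j v^k ∂_l`. It is the vector determined by
`G (Γ u v) w = 1/2 * (D_u G v w + D_v G u w - D_w G u v)` for all `w`; the covariant derivative of
vector fields is `∇_u V = D_u V + Γ u V`. -/
def christoffel (y u v : Eu n) : Eu n :=
  (G y).inverse ((1 / 2 : ℝ) •
    (fderiv ℝ G y u v + fderiv ℝ G y v u - ((fderiv ℝ G y).flip u).flip v))

/-- The curvature tensor `R(u, v) w = ∇_u ∇_v w - ∇_v ∇_u w - ∇_{[u, v]} w` in coordinates. -/
def riemCurv (y u v w : Eu n) : Eu n :=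
  fderiv ℝ (fun z => christoffel G z v w) y u - fderiv ℝ (fun z => christoffel G z u w) y v
    + christoffel G y u (christoffel G y v w) - christoffel G y v (christoffel G y u w)

/-- The Ricci tensor `Ric(v, w) = tr (u ↦ R(u, v) w)`. -/
def ricciForm (y v w : Eu n) : ℝ := ∑ i, bco i (riemCurv G y (bv i) v w)

/-- The fully covariant curvature tensor `Rm(u, v, w, z) = G (R(u, v) w) z`. -/
def riemForm (y u v w z : Eu n) : ℝ := G y (riemCurv G y u v w) z

/-- The raised basis covector `dx^i`: the vector `∑ j, g^{ij} ∂_j`. -/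
def raised (y : Eu n) (i : Fin n) : Eu n := (G y).inverse (bco i)

/-- The pointwise norm of the curvature tensor with respect to the metric `G`, that is the square
root of `R_{ijkl} R^{ijkl}`, where the indices are raised with the inverse of `G`. -/
def riemNorm (y : Eu n) : ℝ :=
  Real.sqrt (∑ i, ∑ j, ∑ k, ∑ l, riemForm G y (bv i) (bv j) (bv k) (bv l) *
    riemForm G y (raised G y i) (raised G y j) (raised G y k) (raised G y l))

end LocalFormulas

section OneMetric

variable {n : ℕ} {M : Type*} [TopologicalSpace M] [ChartedSpace (Eu n) M]
  [IsManifold (𝓡 n) ∞ M]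

/-- The inner product of `g` on the tangent space `T_x M`. Mathlib represents a tangent vector at `x`
by its coordinates in the preferred chart at `x`, an element of `ℝⁿ`. -/
def innerAt (g : Metr n M) (x : M) : Eu n →L[ℝ] Eu n →L[ℝ] ℝ := g.inner x

/-- The pullback `f^* g`, at the point `y`, of a metric `g` on `M` by a map `f` from
(an open subset of) `ℝⁿ` to `M`. -/
def pullMetric (g : Metr n M) (f : Eu n → M) (y : Eu n) : Eu n →L[ℝ] Eu n →L[ℝ] ℝ :=
  let D : Eu n →L[ℝ] Eu n := mfderiv (𝓡 n) (𝓡 n) f y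
  (innerAt g (f y)).bilinearComp D D

/-- The metric `g` in the coordinates given by the preferred chart at `x₀`. Only its values on the
open set `(extChartAt (𝓡 n) x₀).target` are meaningful. -/
def coordMetric (g : Metr n M) (x₀ : M) : Eu n → Eu n →L[ℝ] Eu n →L[ℝ] ℝ :=
  pullMetric g (extChartAt (𝓡 n) x₀).symm

/-- The Ricci tensor of `g` at `x`, computed in the preferred chart at `x`, by which tangent vectors
at `x` are represented. -/
def ricci (g : Metr n M) (x : M) (v w : Eu n) : ℝ :=
  ricciForm (coordMetric g x) (extChartAt (𝓡 n) x x) v w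

/-- The pointwise norm `|Rm(g)|_g (x)` of the curvature tensor of `g`. -/
def rmNorm (g : Metr n M) (x : M) : ℝ :=
  riemNorm (coordMetric g x) (extChartAt (𝓡 n) x x)

/-- The Riemannian distance of `g`: the infimum of the lengths of paths. -/
def gdist (g : Metr n M) (x y : M) : ℝ≥0∞ :=
  letI : Bundle.RiemannianBundle (fun x : M => TangentSpace (𝓡 n) x) := ⟨g.toRiemannianMetric⟩
  Manifold.riemannianEDist (𝓡 n) x y

/-- The open ball `B_g(p, r)`. -/
def gball (g : Metr n M) (p : M) (r : ℝ) : Set M := {x | gdist g p x < ENNReal.ofReal r}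

/-- `(M, g)` is complete: every sequence that is Cauchy for the Riemannian distance converges. -/
def IsCompleteMetric (g : Metr n M) : Prop :=
  ∀ u : ℕ → M, (∀ ε : ℝ≥0∞, 0 < ε → ∃ N, ∀ k ≥ N, ∀ l ≥ N, gdist g (u k) (u l) < ε) →
    ∃ x, Tendsto (fun k => gdist g (u k) x) atTop (𝓝 0)

/-- `γ` is a geodesic of `g` on the open set of times `s`: it is smooth there and satisfies
`c'' + Γ(c', c') = 0`, where `c` is `γ` in coordinates. -/
def IsGeodesicOn (g : Metr n M) (γ : ℝ → M) (s : Set ℝ) : Prop :=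
  ContMDiffOn 𝓘(ℝ, ℝ) (𝓡 n) ∞ γ s ∧
  ∀ t ∈ s,
    let c : ℝ → Eu n := fun τ => extChartAt (𝓡 n) (γ t) (γ τ)
    deriv (deriv c) t + christoffel (coordMetric g (γ t)) (c t) (deriv c t) (deriv c t) = 0

end OneMetric

/-- `f` restricts to a diffeomorphism from `s` onto its image. -/
def IsDiffeoOntoImage {n : ℕ} {M N : Type*} [TopologicalSpace M] [ChartedSpace (Eu n) M]
    [TopologicalSpace N] [ChartedSpace (Eu n) N] (f : M → N) (s : Set M) : Prop :=
  ContMDiffOn (𝓡 n) (𝓡 n) ∞ f s ∧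
  ∃ h : N → M, ContMDiffOn (𝓡 n) (𝓡 n) ∞ h (f '' s) ∧ LeftInvOn h f s

section InjectivityRadius

variable {n : ℕ} {M : Type*} [TopologicalSpace M] [ChartedSpace (Eu n) M]
  [IsManifold (𝓡 n) ∞ M]

/-- The open ball of radius `r` about the origin of the tangent space at `p`, for the norm given
by `g`. -/
def tangentBall (g : Metr n M) (p : M) (r : ℝ) : Set (Eu n) :=
  {v | innerAt g p v v < r ^ 2}

/-- On the ball of radius `r` in `T_p M` the map `e` is the exponential map of `g` at `p`: for each
`v` in the ball, `t ↦ e (t v)` is the geodesic starting at `p` with velocity `v`. -/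
def IsExpOn (g : Metr n M) (p : M) (r : ℝ) (e : Eu n → M) : Prop :=
  e 0 = p ∧ ∀ v ∈ tangentBall g p r,
    IsGeodesicOn g (fun t : ℝ => e (t • v)) {t : ℝ | t • v ∈ tangentBall g p r} ∧
    deriv (fun t : ℝ => extChartAt (𝓡 n) p (e (t • v))) 0 = v

/-- The injectivity radius `inj(M, g, p)`: the supremum of all `r > 0` such that the exponential
map at `p` is defined on the ball of radius `r` in `T_p M` and is a diffeomorphism from it onto its
image. -/
def injRadius (g : Metr n M) (p : M) : ℝ≥0∞ :=
  ⨆ (r : ℝ) (_ : 0 < r ∧ ∃ e : Eu n → M, IsExpOn g p r e ∧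
    IsDiffeoOntoImage (n := n) e (tangentBall g p r)), ENNReal.ofReal r

end InjectivityRadius

/-! ### Ricci flows and their convergence -/

/-- The open interval `(a, b)` of times, where `-∞ ≤ a` and `b ≤ ∞`. -/
def timeInterval (a b : EReal) : Set ℝ := {t | a < (t : EReal) ∧ (t : EReal) < b}

set_option synthInstance.maxHeartbeats 200000 in
/-- `g` is a (smooth) Ricci flow on `M` for `t ∈ (a, b)`: a family of Riemannian metrics that is
smooth in space and time, with `∂g/∂t = -2 Ric(g)`. The values `g t` for `t ∉ (a, b)` are
irrelevant. -/
structure IsRicciFlow {n : ℕ} {M : Type*} [TopologicalSpace M] [ChartedSpace (Eu n) M]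
    [IsManifold (𝓡 n) ∞ M] (g : ℝ → Metr n M) (a b : EReal) : Prop where
  smooth : ∀ x₀ : M, ContDiffOn ℝ ∞ (fun q : ℝ × Eu n => coordMetric (g q.1) x₀ q.2)
    (timeInterval a b ×ˢ (extChartAt (𝓡 n) x₀).target)
  flow : ∀ t ∈ timeInterval a b, ∀ (x : M) (v w : Eu n),
    HasDerivAt (fun s => innerAt (g s) x v w) (-2 * ricci (g t) x v w) t

set_option synthInstance.maxHeartbeats 200000 in
/-- Hamilton-Cheeger-Gromov convergence `(N i, g i t, p i) → (M, h t, q)` for `t ∈ (a, b)`: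
there are compact sets `Ω i` exhausting `M` (each compact set lies in all but finitely many of
them), with `q` in their interiors, and maps `φ i : Ω i → N i`, diffeomorphic onto their images,
with `φ i q = p i`, such that the metrics `(φ i)^* (g i t)` converge to `h t` smoothly locally on
`M × (a, b)`. The last condition says that in each chart `ψ` of `M` all the partial derivatives
in space and time of the components converge uniformly on compact sets; the metric
`(φ i)^* (g i t)` reads `(φ i ∘ ψ⁻¹)^* (g i t)` in the chart. -/
def HCGConverges {n : ℕ} {N : ℕ → Type*} [∀ i, TopologicalSpace (N i)]
    [∀ i, ChartedSpace (Eu n) (N i)] [∀ i, IsManifold (𝓡 n) ∞ (N i)]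
    {M : Type*} [TopologicalSpace M] [ChartedSpace (Eu n) M] [IsManifold (𝓡 n) ∞ M]
    (g : ∀ i, ℝ → Metr n (N i)) (p : ∀ i, N i) (h : ℝ → Metr n M) (q : M) (a b : EReal) : Prop :=
  ∃ (Ω : ℕ → Set M) (φ : ∀ i, M → N i),
    (∀ i, IsCompact (Ω i)) ∧
    (∀ K : Set M, IsCompact K → ∀ᶠ i in atTop, K ⊆ Ω i) ∧
    (∀ i, q ∈ interior (Ω i)) ∧
    (∀ i, IsDiffeoOntoImage (n := n) (φ i) (Ω i)) ∧
    (∀ i, φ i q = p i) ∧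
    ∀ (x₀ : M) (k : ℕ) (K : Set (ℝ × Eu n)), IsCompact K →
      K ⊆ timeInterval a b ×ˢ (extChartAt (𝓡 n) x₀).target →
      TendstoUniformlyOn
        (fun i => iteratedFDeriv ℝ k (fun z : ℝ × Eu n =>
          pullMetric (g i z.1) (φ i ∘ (extChartAt (𝓡 n) x₀).symm) z.2))
        (iteratedFDeriv ℝ k (fun z : ℝ × Eu n => coordMetric (h z.1) x₀ z.2))
        atTop K

/-- The pointed Ricci flow `(M, h t, q)`, `t ∈ (a, b)`, is a limit flow of the sequence of pointed
flows `(N i, g i t, p i)`: it is a Ricci flow, `(M, h 0)` is complete, and a subsequence converges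
to it in the sense of Hamilton-Cheeger-Gromov. -/
structure IsLimitFlow {n : ℕ} {N : ℕ → Type*} [∀ i, TopologicalSpace (N i)]
    [∀ i, ChartedSpace (Eu n) (N i)] [∀ i, IsManifold (𝓡 n) ∞ (N i)]
    {M : Type*} [TopologicalSpace M] [ChartedSpace (Eu n) M] [IsManifold (𝓡 n) ∞ M]
    (g : ∀ i, ℝ → Metr n (N i)) (p : ∀ i, N i) (h : ℝ → Metr n M) (q : M)
    (a b : EReal) : Prop where
  ricciFlow : IsRicciFlow h a b
  complete_zero : IsCompleteMetric (h 0)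
  converges : ∃ σ : ℕ → ℕ, StrictMono σ ∧
    HCGConverges (fun i => g (σ i)) (fun i => p (σ i)) h q a b

end RicciLimit

end

/-!
Why the theorem holds. On the approximating flows `∂g/∂t = -2 Ric`, and a bound `|Rm| ≤ C` bounds
the Ricci tensor by a multiple of the metric (`abs_ricciForm_le`). At a point where this bound holds
at all times, the metrics at two times `s`, `t` are therefore comparable with factor
`exp (D |t - s|)`, where `D` depends only on `n` and `C` (`IsRicciFlow.innerAt_le`).

Each point `x` of the limit is mapped by the comparison maps `φ i` into one fixed ball about the base
points, for all large `i`: locally uniform convergence of the metrics at time `0` bounds the lengths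
of the images of coordinate segments (`exists_nhds_gdist_le`), and connectedness does the rest
(`exists_gdist_le_of_connected`). Hence the comparison holds at `φ i x` for large `i`.

The comparison of `g i t` with `g i s` is an inequality between quadratic forms. It can be pulled
back by `φ i` and passes to the limit under pointwise convergence of the metrics
(`innerAt_le_of_tendsto`). So neither the convergence of derivatives of the metrics nor the
invariance of the curvature under diffeomorphisms is needed. The metrics `h t` and `h 0` are thus
globally comparable on the limit, with a factor depending only on `t`, and completeness passes from
`h 0` to `h t` (`IsCompleteMetric.of_comparable`).
-/

noncomputable section

namespace RicciLimit

-- towers of spaces of continuous linear maps need a deeper search for instances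
set_option synthInstance.maxHeartbeats 200000
set_option maxSynthPendingDepth 3

/-! ### Traces in orthonormal frames -/

section Trace

variable {n : ℕ}

lemma sum_bco_smul_bv (v : Eu n) : ∑ i, bco i v • bv i = v := by
  ext j
  simp [bco, bv, Finset.sum_apply, Pi.single_apply]

/-- A positive definite symmetric bilinear form on `ℝⁿ` has an orthonormal frame. Of orthonormality
only the expansion of vectors in the frame is recorded; for `n` vectors in `ℝⁿ` it is equivalent. -/
lemma exists_orthonormal_frame (B : Eu n →L[ℝ] Eu n →L[ℝ] ℝ) (hs : ∀ u v, B u v = B v u)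
    (hp : ∀ v, v ≠ 0 → 0 < B v v) :
    ∃ f : Fin n → Eu n, ∀ v, ∑ a, B (f a) v • f a = v := by
  let B' : LinearMap.BilinForm ℝ (Eu n) := B.toLinearMap₁₂
  have hB' : ∀ u v, B' u v = B u v := fun _ _ => rfl
  have hsymm : LinearMap.IsSymm B' := ⟨fun u v => by simpa [hB'] using hs u v⟩
  obtain ⟨e, he⟩ := LinearMap.BilinForm.exists_orthogonal_basis hsymm
  have hfr : Module.finrank ℝ (Eu n) = n := by simp
  let e' := e.reindex (finCongr hfr)
  have ho : ∀ a b, a ≠ b → B (e' a) (e' b) = 0 := by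
    intro a b hab
    simp only [e', Module.Basis.reindex_apply]
    exact he ((finCongr hfr).symm.injective.ne hab)
  have hpos : ∀ a, 0 < B (e' a) (e' a) := fun a => hp _ (e'.ne_zero a)
  refine ⟨fun a => (√(B (e' a) (e' a)))⁻¹ • e' a, fun v => ?_⟩
  have key : ∀ a, B (e' a) v = e'.repr v a * B (e' a) (e' a) := by
    intro a
    conv_lhs => rw [← e'.sum_repr v]
    rw [map_sum, Finset.sum_eq_single a]
    · simp
    · intro b _ hb
      simp [ho a b hb.symm]
    · simp
  conv_rhs => rw [← e'.sum_repr v]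
  refine Finset.sum_congr rfl fun a _ => ?_
  have h1 := Real.mul_self_sqrt (hpos a).le
  have h2 : √(B (e' a) (e' a)) ≠ 0 := (Real.sqrt_pos.2 (hpos a)).ne'
  rw [map_smul, smul_apply, key, smul_smul]
  congr 1
  nth_rewrite 2 [← h1]
  rw [smul_eq_mul]
  field_simp

lemma isInvertible_of_posDef (B : Eu n →L[ℝ] Eu n →L[ℝ] ℝ) (hp : ∀ v, v ≠ 0 → 0 < B v v) :
    B.IsInvertible := by
  have hinj : Function.Injective B := by
    rw [injective_iff_map_eq_zero]
    intro v hv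
    by_contra h
    simpa [hv] using hp v h
  have hd : Module.finrank ℝ (Eu n) = Module.finrank ℝ (Eu n →L[ℝ] ℝ) := by
    rw [← LinearEquiv.finrank_eq (LinearMap.toContinuousLinearMap (𝕜 := ℝ) (E := Eu n) (F' := ℝ))]
    exact (Subspace.dual_finrank_eq).symm
  have hbij : Function.Bijective (B : Eu n →ₗ[ℝ] Eu n →L[ℝ] ℝ) :=
    ⟨hinj, (LinearMap.injective_iff_surjective_of_finrank_eq_finrank hd).1 hinj⟩
  exact ⟨(LinearEquiv.ofBijective _ hbij).toContinuousLinearEquiv, by ext; rfl⟩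

/-- The contraction of a bilinear form with the inverse metric is its trace in an orthonormal
frame. -/
lemma sum_bv_raised {G : Eu n → Eu n →L[ℝ] Eu n →L[ℝ] ℝ} {y : Eu n}
    (hs : ∀ u v, G y u v = G y v u) (hi : (G y).IsInvertible) {f : Fin n → Eu n}
    (hf : ∀ v, ∑ a, G y (f a) v • f a = v) (T : Eu n →ₗ[ℝ] Eu n →ₗ[ℝ] ℝ) :
    ∑ i, T (bv i) (raised G y i) = ∑ a, T (f a) (f a) := by
  have hr : ∀ i, raised G y i = ∑ a, bco i (f a) • f a := by
    intro i
    conv_lhs => rw [← hf (raised G y i)]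
    refine Finset.sum_congr rfl fun a _ => ?_
    rw [hs, raised, hi.self_apply_inverse]
  simp_rw [hr, map_sum, map_smul]
  rw [Finset.sum_comm]
  refine Finset.sum_congr rfl fun a _ => ?_
  have h := congrArg (fun u => T u (f a)) (sum_bco_smul_bv (f a))
  simpa [map_sum] using h

lemma sum_mul_bv_raised {G : Eu n → Eu n →L[ℝ] Eu n →L[ℝ] ℝ} {y : Eu n}
    (hs : ∀ u v, G y u v = G y v u) (hi : (G y).IsInvertible) {f : Fin n → Eu n}
    (hf : ∀ v, ∑ a, G y (f a) v • f a = v) {A B : Eu n → ℝ} (hA : IsLinearMap ℝ A)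
    (hB : IsLinearMap ℝ B) :
    ∑ i, A (bv i) * B (raised G y i) = ∑ a, A (f a) * B (f a) :=
  sum_bv_raised hs hi hf ((LinearMap.mul ℝ ℝ).compl₁₂ (hA.mk' A) (hB.mk' B))

/-- The squared norm of a covariant 4-tensor, computed with the inverse metric, is the sum of the
squares of its components in an orthonormal frame. -/
lemma sum_tensor_raised {G : Eu n → Eu n →L[ℝ] Eu n →L[ℝ] ℝ} {y : Eu n}
    (hs : ∀ u v, G y u v = G y v u) (hi : (G y).IsInvertible) {f : Fin n → Eu n}
    (hf : ∀ v, ∑ a, G y (f a) v • f a = v) {T : Eu n → Eu n → Eu n → Eu n → ℝ}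
    (h1 : ∀ v w z, IsLinearMap ℝ (fun u => T u v w z))
    (h2 : ∀ u w z, IsLinearMap ℝ (fun v => T u v w z))
    (h3 : ∀ u v z, IsLinearMap ℝ (fun w => T u v w z))
    (h4 : ∀ u v w, IsLinearMap ℝ (fun z => T u v w z)) :
    ∑ i, ∑ j, ∑ k, ∑ l, T (bv i) (bv j) (bv k) (bv l) *
        T (raised G y i) (raised G y j) (raised G y k) (raised G y l)
      = ∑ a, ∑ b, ∑ c, ∑ d, T (f a) (f b) (f c) (f d) ^ 2 := by
  have swap : ∀ F F' : Fin n → Fin n → ℝ, (∀ d, ∑ i, F i d = ∑ i, F' i d) →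
      ∑ i, ∑ d, F i d = ∑ i, ∑ d, F' i d := fun F F' h => by
    rw [Finset.sum_comm, Finset.sum_comm (f := F')]
    exact Finset.sum_congr rfl fun d _ => h d
  -- one index at a time, from the last to the first
  have s4 : ∀ u v w u' v' w', ∑ l, T u v w (bv l) * T u' v' w' (raised G y l)
      = ∑ d, T u v w (f d) * T u' v' w' (f d) := fun u v w u' v' w' =>
    sum_mul_bv_raised hs hi hf (h4 u v w) (h4 u' v' w')
  have s3 : ∀ u v u' v', ∑ k, ∑ d, T u v (bv k) (f d) * T u' v' (raised G y k) (f d)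
      = ∑ c, ∑ d, T u v (f c) (f d) * T u' v' (f c) (f d) := fun u v u' v' =>
    swap _ _ fun d => sum_mul_bv_raised hs hi hf (h3 u v (f d)) (h3 u' v' (f d))
  have s2 : ∀ u u', ∑ j, ∑ c, ∑ d, T u (bv j) (f c) (f d) * T u' (raised G y j) (f c) (f d)
      = ∑ b, ∑ c, ∑ d, T u (f b) (f c) (f d) * T u' (f b) (f c) (f d) := fun u u' =>
    swap _ _ fun c => swap _ _ fun d =>
      sum_mul_bv_raised hs hi hf (h2 u (f c) (f d)) (h2 u' (f c) (f d))
  simp_rw [s4, s3, s2, sq]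
  exact swap _ _ fun b => swap _ _ fun c => swap _ _ fun d =>
    sum_mul_bv_raised hs hi hf (h1 (f b) (f c) (f d)) (h1 (f b) (f c) (f d))

lemma abs_le_sqrt_sum_sq (X : Fin n → Fin n → Fin n → Fin n → ℝ) (a b c d : Fin n) :
    |X a b c d| ≤ √(∑ a, ∑ b, ∑ c, ∑ d, X a b c d ^ 2) := by
  have p1 : ∀ a b c d, 0 ≤ X a b c d ^ 2 := fun a b c d => sq_nonneg _
  have p2 : ∀ a b c, 0 ≤ ∑ d, X a b c d ^ 2 := fun a b c => Finset.sum_nonneg fun d _ => p1 a b c d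
  have p3 : ∀ a b, 0 ≤ ∑ c, ∑ d, X a b c d ^ 2 := fun a b => Finset.sum_nonneg fun c _ => p2 a b c
  have p4 : ∀ a, 0 ≤ ∑ b, ∑ c, ∑ d, X a b c d ^ 2 := fun a => Finset.sum_nonneg fun b _ => p3 a b
  exact Real.abs_le_sqrt <|
    (Finset.single_le_sum (fun d _ => p1 a b c d) (Finset.mem_univ d)).trans <|
    (Finset.single_le_sum (fun c _ => p2 a b c) (Finset.mem_univ c)).trans <|
    (Finset.single_le_sum (fun b _ => p3 a b) (Finset.mem_univ b)).trans <|
    Finset.single_le_sum (fun a _ => p4 a) (Finset.mem_univ a)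

end Trace

/-! ### Linearity and regularity of the curvature tensor -/

section Koszul

variable {E : Type*} [NormedAddCommGroup E] [NormedSpace ℝ E]

/-- The right hand side of the Koszul formula as a function of the derivative `D` of the metric:
the covector `w ↦ 1/2 * (D u v w + D v u w - D w u v)`. -/
def koszul (D : E →L[ℝ] E →L[ℝ] E →L[ℝ] ℝ) (u v : E) : E →L[ℝ] ℝ :=
  (1 / 2 : ℝ) • (D u v + D v u - (D.flip u).flip v)

lemma koszul_add_left (D : E →L[ℝ] E →L[ℝ] E →L[ℝ] ℝ) (u u' v : E) :
    koszul D (u + u') v = koszul D u v + koszul D u' v := by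
  ext w; simp [koszul]; ring

lemma koszul_smul_left (D : E →L[ℝ] E →L[ℝ] E →L[ℝ] ℝ) (c : ℝ) (u v : E) :
    koszul D (c • u) v = c • koszul D u v := by
  ext w; simp [koszul]; ring

lemma koszul_add_right (D : E →L[ℝ] E →L[ℝ] E →L[ℝ] ℝ) (u v v' : E) :
    koszul D u (v + v') = koszul D u v + koszul D u v' := by
  ext w; simp [koszul]; ring

lemma koszul_smul_right (D : E →L[ℝ] E →L[ℝ] E →L[ℝ] ℝ) (c : ℝ) (u v : E) :
    koszul D u (c • v) = c • koszul D u v := by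
  ext w; simp [koszul]; ring

lemma _root_.DifferentiableAt.koszul {D : E → E →L[ℝ] E →L[ℝ] E →L[ℝ] ℝ} {y : E}
    (hD : DifferentiableAt ℝ D y) (u v : E) :
    DifferentiableAt ℝ (fun z => koszul (D z) u v) y := by
  have h : ∀ z, ((D z).flip u).flip v = ((ContinuousLinearMap.apply ℝ ℝ v).comp
      (ContinuousLinearMap.apply ℝ (E →L[ℝ] ℝ) u)).comp (D z) := fun z => by ext; simp
  simp only [RicciLimit.koszul, h]
  have h1 : DifferentiableAt ℝ (fun z => D z u v) y := by fun_prop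
  have h2 : DifferentiableAt ℝ (fun z => D z v u) y := by fun_prop
  have h3 : DifferentiableAt ℝ (fun z => ((ContinuousLinearMap.apply ℝ ℝ v).comp
      (ContinuousLinearMap.apply ℝ (E →L[ℝ] ℝ) u)).comp (D z)) y :=
    (differentiableAt_const _).clm_comp hD
  exact ((h1.add h2).sub h3).const_smul (1 / 2 : ℝ)

lemma differentiableAt_inverse_koszul [CompleteSpace E] {G : E → E →L[ℝ] E →L[ℝ] ℝ} {y : E}
    (hG : ContDiffAt ℝ 2 G y) (hi : (G y).IsInvertible) (u v : E) :
    DifferentiableAt ℝ (fun z => (G z).inverse (koszul (fderiv ℝ G z) u v)) y := by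
  have h1 : DifferentiableAt ℝ (fun z => (G z).inverse) y :=
    ((hi.contDiffAt_map_inverse (n := 1)).differentiableAt (by simp)).comp y
      (hG.differentiableAt (by simp))
  have h2 : DifferentiableAt ℝ (fderiv ℝ G) y :=
    (hG.fderiv_right (m := 1) (by norm_num)).differentiableAt (by simp)
  exact h1.clm_apply (h2.koszul u v)

end Koszul

section Curvature

variable {n : ℕ} {G : Eu n → Eu n →L[ℝ] Eu n →L[ℝ] ℝ} {y : Eu n}

lemma christoffel_eq_koszul (z u v : Eu n) :
    christoffel G z u v = (G z).inverse (koszul (fderiv ℝ G z) u v) := rfl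

lemma christoffel_isLinearMap_left (z v : Eu n) :
    IsLinearMap ℝ (fun u => christoffel G z u v) where
  map_add u u' := by simp only [christoffel_eq_koszul, koszul_add_left, map_add]
  map_smul c u := by simp only [christoffel_eq_koszul, koszul_smul_left, map_smul]

lemma christoffel_isLinearMap_right (z u : Eu n) :
    IsLinearMap ℝ (fun v => christoffel G z u v) where
  map_add v v' := by simp only [christoffel_eq_koszul, koszul_add_right, map_add]
  map_smul c v := by simp only [christoffel_eq_koszul, koszul_smul_right, map_smul]

lemma differentiableAt_christoffel (hG : ContDiffAt ℝ 2 G y) (hi : (G y).IsInvertible)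
    (u v : Eu n) : DifferentiableAt ℝ (fun z => christoffel G z u v) y :=
  differentiableAt_inverse_koszul hG hi u v

lemma riemCurv_isLinearMap_left (hG : ContDiffAt ℝ 2 G y) (hi : (G y).IsInvertible)
    (v w : Eu n) : IsLinearMap ℝ (fun u => riemCurv G y u v w) where
  map_add u u' := by
    have h : (fun z => christoffel G z (u + u') w)
        = (fun z => christoffel G z u w) + fun z => christoffel G z u' w :=
      funext fun z => (christoffel_isLinearMap_left z w).map_add u u'
    simp only [riemCurv, h]
    rw [fderiv_add (differentiableAt_christoffel hG hi u w)
      (differentiableAt_christoffel hG hi u' w)]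
    simp only [map_add, add_apply, (christoffel_isLinearMap_left y _).map_add,
      (christoffel_isLinearMap_right y _).map_add]
    abel
  map_smul c u := by
    have h : (fun z => christoffel G z (c • u) w) = c • fun z => christoffel G z u w :=
      funext fun z => (christoffel_isLinearMap_left z w).map_smul c u
    simp only [riemCurv, h]
    rw [fderiv_const_smul (differentiableAt_christoffel hG hi u w)]
    simp only [map_smul, smul_apply, (christoffel_isLinearMap_left y _).map_smul,
      (christoffel_isLinearMap_right y _).map_smul, smul_add, smul_sub]

lemma riemCurv_antisymm (u v w : Eu n) : riemCurv G y u v w = -riemCurv G y v u w := by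
  simp only [riemCurv]
  abel

lemma riemCurv_isLinearMap_right (hG : ContDiffAt ℝ 2 G y) (hi : (G y).IsInvertible)
    (u v : Eu n) : IsLinearMap ℝ (fun w => riemCurv G y u v w) where
  map_add w w' := by
    have h : ∀ u, (fun z => christoffel G z u (w + w'))
        = (fun z => christoffel G z u w) + fun z => christoffel G z u w' := fun u =>
      funext fun z => (christoffel_isLinearMap_right z u).map_add w w'
    simp only [riemCurv, h]
    rw [fderiv_add (differentiableAt_christoffel hG hi _ _)
      (differentiableAt_christoffel hG hi _ _), fderiv_add (differentiableAt_christoffel hG hi _ _)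
      (differentiableAt_christoffel hG hi _ _)]
    simp only [add_apply, (christoffel_isLinearMap_right y _).map_add]
    abel
  map_smul c w := by
    have h : ∀ u, (fun z => christoffel G z u (c • w)) = c • fun z => christoffel G z u w :=
      fun u => funext fun z => (christoffel_isLinearMap_right z u).map_smul c w
    simp only [riemCurv, h]
    rw [fderiv_const_smul (differentiableAt_christoffel hG hi _ _),
      fderiv_const_smul (differentiableAt_christoffel hG hi _ _)]
    simp only [smul_apply, (christoffel_isLinearMap_right y _).map_smul, smul_add, smul_sub]

/-! ### Curvature bounds the Ricci tensor -/

/-- A bound for the norm of the curvature tensor bounds the Ricci tensor in terms of the metric.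
The constant `n ^ 3` is not sharp: it counts the curvature components of the expansion of
`Ric(v, v)` in an orthonormal frame. -/
lemma abs_ricciForm_le (hG : ContDiffAt ℝ 2 G y) (hs : ∀ u v, G y u v = G y v u)
    (hp : ∀ v, v ≠ 0 → 0 < G y v v) {C : ℝ} (hC : riemNorm G y ≤ C) (v : Eu n) :
    |ricciForm G y v v| ≤ n ^ 3 * C * G y v v := by
  have hi := isInvertible_of_posDef (G y) hp
  obtain ⟨f, hf⟩ := exists_orthonormal_frame (G y) hs hp
  have l1 := riemCurv_isLinearMap_left hG hi
  have l2 : ∀ u w, IsLinearMap ℝ (fun v => riemCurv G y u v w) := fun u w => by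
    simp_rw [riemCurv_antisymm u _ w]
    exact ((l1 u w).mk' _ |> Neg.neg).isLinear
  have l3 := riemCurv_isLinearMap_right hG hi
  have hnorm : riemNorm G y
      = √(∑ a, ∑ b, ∑ c, ∑ d, riemForm G y (f a) (f b) (f c) (f d) ^ 2) := by
    rw [riemNorm, sum_tensor_raised hs hi hf (T := riemForm G y)]
    · exact fun v w z => ⟨fun _ _ => by simp [riemForm, (l1 v w).map_add],
        fun _ _ => by simp [riemForm, (l1 v w).map_smul]⟩
    · exact fun u w z => ⟨fun _ _ => by simp [riemForm, (l2 u w).map_add],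
        fun _ _ => by simp [riemForm, (l2 u w).map_smul]⟩
    · exact fun u v z => ⟨fun _ _ => by simp [riemForm, (l3 u v).map_add],
        fun _ _ => by simp [riemForm, (l3 u v).map_smul]⟩
    · exact fun u v w => ⟨fun _ _ => by simp [riemForm], fun _ _ => by simp [riemForm]⟩
  have hcomp : ∀ a b c d, |riemForm G y (f a) (f b) (f c) (f d)| ≤ C := by
    intro a b c d
    refine le_trans ?_ hC
    rw [hnorm]
    exact abs_le_sqrt_sum_sq (fun a b c d => riemForm G y (f a) (f b) (f c) (f d)) a b c d
  -- the Ricci tensor as a trace in the orthonormal frame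
  have htr : ricciForm G y v v = ∑ a, riemForm G y (f a) v v (f a) := by
    have h := sum_bv_raised hs hi hf ((G y).toLinearMap₁₂ ∘ₗ (l1 v v).mk' _)
    refine Eq.trans (Finset.sum_congr rfl fun i _ => ?_) h
    change _ = G y (riemCurv G y (bv i) v v) (raised G y i)
    rw [hs, raised, hi.self_apply_inverse]
  have hexp : ∀ a, riemForm G y (f a) v v (f a) = ∑ b, ∑ c,
      G y (f b) v * G y (f c) v * riemForm G y (f a) (f b) (f c) (f a) := by
    intro a
    have e2 : ∀ w, riemForm G y (f a) v w (f a)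
        = ∑ b, G y (f b) v * riemForm G y (f a) (f b) w (f a) := by
      intro w
      have := map_sum ((l2 (f a) w).mk' _) (fun b => G y (f b) v • f b) Finset.univ
      rw [hf] at this
      simp only [IsLinearMap.mk'_apply, (l2 (f a) w).map_smul] at this
      simp [riemForm, this]
    have e3 : ∀ u, riemForm G y (f a) u v (f a)
        = ∑ c, G y (f c) v * riemForm G y (f a) u (f c) (f a) := by
      intro u
      have := map_sum ((l3 (f a) u).mk' _) (fun b => G y (f b) v • f b) Finset.univ
      rw [hf] at this
      simp only [IsLinearMap.mk'_apply, (l3 (f a) u).map_smul] at this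
      simp [riemForm, this]
    rw [e2]
    simp_rw [e3, Finset.mul_sum, mul_assoc]
  have hparseval : G y v v = ∑ a, G y (f a) v ^ 2 := by
    have h := congrArg (fun u => G y u v) (hf v)
    simp only [map_sum, map_smul] at h
    simpa [sq] using h.symm
  have hcoef : ∀ b c, |G y (f b) v * G y (f c) v| ≤ G y v v := by
    intro b c
    have hb := Finset.single_le_sum (f := fun a => G y (f a) v ^ 2)
      (fun _ _ => by positivity) (Finset.mem_univ b)
    have hc := Finset.single_le_sum (f := fun a => G y (f a) v ^ 2)
      (fun _ _ => by positivity) (Finset.mem_univ c)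
    rw [← hparseval] at hb hc
    rw [abs_le]
    constructor <;> nlinarith [sq_nonneg (G y (f b) v + G y (f c) v),
      sq_nonneg (G y (f b) v - G y (f c) v)]
  have hterm : ∀ a b c, |G y (f b) v * G y (f c) v * riemForm G y (f a) (f b) (f c) (f a)|
      ≤ C * G y v v := by
    intro a b c
    rw [abs_mul, mul_comm C]
    exact mul_le_mul (hcoef b c) (hcomp a b c a) (abs_nonneg _)
      ((abs_nonneg _).trans (hcoef b c))
  rw [htr]
  simp_rw [hexp]
  calc _ ≤ ∑ a : Fin n, ∑ b : Fin n, ∑ c : Fin n, C * G y v v :=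
        (Finset.abs_sum_le_sum_abs _ _).trans (Finset.sum_le_sum fun a _ =>
          (Finset.abs_sum_le_sum_abs _ _).trans (Finset.sum_le_sum fun b _ =>
            (Finset.abs_sum_le_sum_abs _ _).trans (Finset.sum_le_sum fun c _ => hterm a b c)))
    _ = n ^ 3 * C * G y v v := by simp; ring

end Curvature

/-! ### Lengths, distances and comparable metrics -/

section Distance

variable {n : ℕ} {M : Type*} [TopologicalSpace M] [ChartedSpace (Eu n) M]
  [IsManifold (𝓡 n) ∞ M]

lemma innerAt_symm (g : Metr n M) (x : M) (v w : Eu n) : innerAt g x v w = innerAt g x w v :=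
  g.symm x v w

lemma innerAt_pos (g : Metr n M) (x : M) (v : Eu n) (hv : v ≠ 0) : 0 < innerAt g x v v :=
  g.pos x v hv

/-- The velocity of a path, as a vector in the preferred chart at the point of the path. -/
def velocity (γ : ℝ → M) (t : ℝ) : Eu n := mfderiv 𝓘(ℝ, ℝ) (𝓡 n) γ t (1 : ℝ)

/-- The length of a path on `[a, b]` for the metric `g`. -/
def pathLength (g : Metr n M) (γ : ℝ → M) (a b : ℝ) : ℝ≥0∞ :=
  ∫⁻ t in Icc a b, ENNReal.ofReal √(innerAt g (γ t) (velocity γ t) (velocity γ t))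

/-- The length used in Mathlib's Riemannian distance is `pathLength`. This form does not mention the
norm instances on the tangent spaces that `g` induces, so that two metrics can be compared. -/
lemma pathELength_eq_pathLength (g : Metr n M) (γ : ℝ → M) (a b : ℝ) :
    letI : Bundle.RiemannianBundle (fun x : M => TangentSpace (𝓡 n) x) := ⟨g.toRiemannianMetric⟩
    Manifold.pathELength (𝓡 n) γ a b = pathLength g γ a b := by
  let _ : Bundle.RiemannianBundle (fun x : M => TangentSpace (𝓡 n) x) := ⟨g.toRiemannianMetric⟩
  rw [Manifold.pathELength_eq_lintegral_mfderiv_Icc, pathLength]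
  congr 1
  ext t
  rw [← ofReal_norm, norm_eq_sqrt_real_inner]
  rfl

lemma gdist_le_pathLength (g : Metr n M) {γ : ℝ → M} {a b : ℝ} (hab : a ≤ b)
    (hγ : ContMDiffOn 𝓘(ℝ, ℝ) (𝓡 n) 1 γ (Icc a b)) :
    gdist g (γ a) (γ b) ≤ pathLength g γ a b := by
  let _ : Bundle.RiemannianBundle (fun x : M => TangentSpace (𝓡 n) x) := ⟨g.toRiemannianMetric⟩
  rw [← pathELength_eq_pathLength]
  exact Manifold.riemannianEDist_le_pathELength hγ rfl rfl hab

lemma exists_path_of_gdist_lt (g : Metr n M) {x y : M} {r : ℝ≥0∞} (h : gdist g x y < r) :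
    ∃ γ : ℝ → M, γ 0 = x ∧ γ 1 = y ∧ ContMDiffOn 𝓘(ℝ, ℝ) (𝓡 n) 1 γ (Icc 0 1) ∧
      pathLength g γ 0 1 < r := by
  let _ : Bundle.RiemannianBundle (fun x : M => TangentSpace (𝓡 n) x) := ⟨g.toRiemannianMetric⟩
  simp only [← pathELength_eq_pathLength]
  exact Manifold.exists_lt_of_riemannianEDist_lt h

lemma gdist_self (g : Metr n M) (x : M) : gdist g x x = 0 := by
  let _ : Bundle.RiemannianBundle (fun x : M => TangentSpace (𝓡 n) x) := ⟨g.toRiemannianMetric⟩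
  exact Manifold.riemannianEDist_self

lemma gdist_comm (g : Metr n M) (x y : M) : gdist g x y = gdist g y x := by
  let _ : Bundle.RiemannianBundle (fun x : M => TangentSpace (𝓡 n) x) := ⟨g.toRiemannianMetric⟩
  exact Manifold.riemannianEDist_comm

lemma gdist_triangle (g : Metr n M) (x y z : M) : gdist g x z ≤ gdist g x y + gdist g y z := by
  let _ : Bundle.RiemannianBundle (fun x : M => TangentSpace (𝓡 n) x) := ⟨g.toRiemannianMetric⟩
  exact Manifold.riemannianEDist_triangle

lemma gdist_le_mul_of_innerAt_le {g g' : Metr n M} {c : ℝ} (hc : 0 < c)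
    (h : ∀ x v, innerAt g x v v ≤ c ^ 2 * innerAt g' x v v) (x y : M) :
    gdist g x y ≤ ENNReal.ofReal c * gdist g' x y := by
  have hc0 : ENNReal.ofReal c ≠ 0 := by simpa using hc
  rw [mul_comm, ← ENNReal.div_le_iff_le_mul (Or.inl hc0) (Or.inl ENNReal.ofReal_ne_top)]
  refine le_of_forall_gt fun r hr => ?_
  obtain ⟨γ, rfl, rfl, hγ, hl⟩ := exists_path_of_gdist_lt g' hr
  refine lt_of_le_of_lt ?_ hl
  rw [ENNReal.div_le_iff_le_mul (Or.inl hc0) (Or.inl ENNReal.ofReal_ne_top), mul_comm]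
  refine (gdist_le_pathLength g zero_le_one hγ).trans ?_
  rw [pathLength, pathLength, ← MeasureTheory.lintegral_const_mul' _ _ ENNReal.ofReal_ne_top]
  refine MeasureTheory.lintegral_mono fun t => ?_
  rw [← ENNReal.ofReal_mul hc.le]
  refine ENNReal.ofReal_le_ofReal ?_
  rw [← Real.sqrt_sq hc.le, ← Real.sqrt_mul (sq_nonneg c)]
  exact Real.sqrt_le_sqrt (h _ _)

/-- Completeness passes from a metric to any metric that is bounded above and below by multiples
of it. -/
lemma IsCompleteMetric.of_comparable {g g' : Metr n M} (hg : IsCompleteMetric g) {c : ℝ}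
    (hc : 0 < c) (h : ∀ x v, innerAt g x v v ≤ c ^ 2 * innerAt g' x v v)
    (h' : ∀ x v, innerAt g' x v v ≤ c ^ 2 * innerAt g x v v) : IsCompleteMetric g' := by
  have hc0 : ENNReal.ofReal c ≠ 0 := by simpa using hc
  intro u hu
  obtain ⟨x, hx⟩ := hg u fun ε hε => by
    obtain ⟨K, hK⟩ := hu (ε / ENNReal.ofReal c) (ENNReal.div_pos hε.ne' ENNReal.ofReal_ne_top)
    refine ⟨K, fun k hk l hl => (gdist_le_mul_of_innerAt_le hc h _ _).trans_lt ?_⟩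
    rw [mul_comm]
    exact (ENNReal.lt_div_iff_mul_lt (Or.inl hc0) (Or.inl ENNReal.ofReal_ne_top)).1 (hK k hk l hl)
  refine ⟨x, ?_⟩
  have := ENNReal.Tendsto.const_mul hx (Or.inr (ENNReal.ofReal_ne_top (r := c)))
  rw [mul_zero] at this
  exact tendsto_of_tendsto_of_tendsto_of_le_of_le tendsto_const_nhds this (fun _ => zero_le)
    fun k => gdist_le_mul_of_innerAt_le hc h' _ _

end Distance

/-! ### Ricci flows with bounded curvature -/

section Flow

variable {n : ℕ} {M : Type*} [TopologicalSpace M] [ChartedSpace (Eu n) M]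
  [IsManifold (𝓡 n) ∞ M]

lemma mfderiv_extChartAt_symm_self (x : M) :
    mfderiv (𝓡 n) (𝓡 n) (extChartAt (𝓡 n) x).symm (extChartAt (𝓡 n) x x)
      = ContinuousLinearMap.id ℝ (Eu n) := by
  have : IsManifold (𝓡 n) 1 M := .of_le (n := ∞) (by simp)
  have h := mfderivWithin_range_extChartAt_symm (I := 𝓡 n) (x := x)
  rw [ModelWithCorners.range_eq_univ, mfderivWithin_univ] at h
  exact h

/-- In the preferred chart at `x` the coordinate metric agrees with `g` at `x` itself, since the
derivative of the chart is the identity there. -/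
lemma coordMetric_self (g : Metr n M) (x : M) :
    coordMetric g x (extChartAt (𝓡 n) x x) = innerAt g x := by
  have hD : (mfderiv (𝓡 n) (𝓡 n) (extChartAt (𝓡 n) x).symm (extChartAt (𝓡 n) x x) :
      Eu n →L[ℝ] Eu n) = ContinuousLinearMap.id ℝ (Eu n) := mfderiv_extChartAt_symm_self x
  have hx : (extChartAt (𝓡 n) x).symm (extChartAt (𝓡 n) x x) = x := extChartAt_to_inv x
  ext v w
  change innerAt g ((extChartAt (𝓡 n) x).symm (extChartAt (𝓡 n) x x))
    ((mfderiv (𝓡 n) (𝓡 n) (extChartAt (𝓡 n) x).symm (extChartAt (𝓡 n) x x) :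
      Eu n →L[ℝ] Eu n) v)
    ((mfderiv (𝓡 n) (𝓡 n) (extChartAt (𝓡 n) x).symm (extChartAt (𝓡 n) x x) :
      Eu n →L[ℝ] Eu n) w) = _
  rw [hD, hx]
  rfl

lemma convex_timeInterval (a b : EReal) : Convex ℝ (timeInterval a b) := by
  refine Set.OrdConnected.convex ⟨fun x hx y hy z hz => ⟨hx.1.trans_le ?_, lt_of_le_of_lt ?_ hy.2⟩⟩
  · exact_mod_cast hz.1
  · exact_mod_cast hz.2

lemma IsRicciFlow.contDiffOn_coordMetric {g : ℝ → Metr n M} {a b : EReal}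
    (hg : IsRicciFlow g a b) {t : ℝ} (ht : t ∈ timeInterval a b) (x : M) :
    ContDiffOn ℝ ∞ (coordMetric (g t) x) (extChartAt (𝓡 n) x).target :=
  have hι : ContDiff ℝ ∞ (fun y : Eu n => (t, y)) := contDiff_const.prodMk contDiff_id
  ContDiffOn.comp (g := fun q : ℝ × Eu n => coordMetric (g q.1) x q.2) (f := fun y => (t, y))
    (hg.smooth x) hι.contDiffOn fun _ hy => ⟨ht, hy⟩

lemma IsRicciFlow.abs_ricci_le {g : ℝ → Metr n M} {a b : EReal} (hg : IsRicciFlow g a b)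
    {t : ℝ} (ht : t ∈ timeInterval a b) {x : M} {C : ℝ} (hC : rmNorm (g t) x ≤ C) (v : Eu n) :
    |ricci (g t) x v v| ≤ n ^ 3 * C * innerAt (g t) x v v := by
  have h := abs_ricciForm_le (G := coordMetric (g t) x) (y := extChartAt (𝓡 n) x x) (C := C) ?_
    ?_ ?_ hC v
  · rwa [coordMetric_self] at h
  · exact ((hg.contDiffOn_coordMetric ht x).contDiffAt
      (extChartAt_target_mem_nhds x)).of_le (by norm_cast)
  · rw [coordMetric_self]
    exact innerAt_symm _ _
  · rw [coordMetric_self]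
    exact innerAt_pos _ _

end Flow

/-- A function with `|u'| ≤ D u` changes at most by the factor `exp (D |t - s|)`. -/
lemma le_exp_mul_of_abs_deriv_le {S : Set ℝ} (hS : Convex ℝ S) {u u' : ℝ → ℝ} {D : ℝ}
    (hu : ∀ t ∈ S, HasDerivAt u (u' t) t) (hD : ∀ t ∈ S, |u' t| ≤ D * u t) {s t : ℝ}
    (hs : s ∈ S) (ht : t ∈ S) : u t ≤ Real.exp (D * |t - s|) * u s := by
  have hd : ∀ c : ℝ, ∀ t ∈ S, HasDerivAt (fun t => Real.exp (c * t) * u t)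
      (Real.exp (c * t) * (c * u t + u' t)) t := fun c t ht => by
    have := (((hasDerivAt_id t).const_mul c).exp).mul (hu t ht)
    convert! this using 1
    simp
    ring
  have hint : ∀ t ∈ interior S, t ∈ S := fun t ht => interior_subset ht
  have cont : ∀ c : ℝ, ContinuousOn (fun t => Real.exp (c * t) * u t) S := fun c t ht =>
    (hd c t ht).continuousAt.continuousWithinAt
  have hmono : MonotoneOn (fun t => Real.exp (D * t) * u t) S :=
    monotoneOn_of_deriv_nonneg hS (cont D)
      (fun t ht => (hd D t (hint t ht)).differentiableAt.differentiableWithinAt) fun t ht => by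
        rw [(hd D t (hint t ht)).deriv]
        have := (abs_le.1 (hD t (hint t ht))).1
        exact mul_nonneg (Real.exp_pos _).le (by linarith)
  have hanti : AntitoneOn (fun t => Real.exp (-D * t) * u t) S :=
    antitoneOn_of_deriv_nonpos hS (cont (-D))
      (fun t ht => (hd (-D) t (hint t ht)).differentiableAt.differentiableWithinAt) fun t ht => by
        rw [(hd (-D) t (hint t ht)).deriv]
        have := (abs_le.1 (hD t (hint t ht))).2
        exact mul_nonpos_of_nonneg_of_nonpos (Real.exp_pos _).le (by linarith)
  rcases le_total s t with hst | hst
  · have h : Real.exp (-D * t) * u t ≤ Real.exp (-D * s) * u s := hanti hs ht hst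
    have e : Real.exp (D * |t - s|) = Real.exp (D * t) * Real.exp (-D * s) := by
      rw [abs_of_nonneg (sub_nonneg.2 hst), ← Real.exp_add]
      ring_nf
    have e1 : Real.exp (D * t) * Real.exp (-D * t) = 1 := by simp [← Real.exp_add]
    calc u t = Real.exp (D * t) * (Real.exp (-D * t) * u t) := by rw [← mul_assoc, e1, one_mul]
      _ ≤ Real.exp (D * t) * (Real.exp (-D * s) * u s) := by gcongr
      _ = _ := by rw [e, mul_assoc]
  · have h : Real.exp (D * t) * u t ≤ Real.exp (D * s) * u s := hmono ht hs hst
    have e : Real.exp (D * |t - s|) = Real.exp (-D * t) * Real.exp (D * s) := by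
      rw [abs_of_nonpos (sub_nonpos.2 hst), ← Real.exp_add]
      ring_nf
    have e1 : Real.exp (-D * t) * Real.exp (D * t) = 1 := by simp [← Real.exp_add]
    calc u t = Real.exp (-D * t) * (Real.exp (D * t) * u t) := by rw [← mul_assoc, e1, one_mul]
      _ ≤ Real.exp (-D * t) * (Real.exp (D * s) * u s) := by gcongr
      _ = _ := by rw [e, mul_assoc]

section FlowComparison

variable {n : ℕ} {M : Type*} [TopologicalSpace M] [ChartedSpace (Eu n) M]
  [IsManifold (𝓡 n) ∞ M]

/-- At a point where the curvature is bounded by `C` at all times, the metrics of a Ricci flow at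
two times are comparable. -/
lemma IsRicciFlow.innerAt_le {g : ℝ → Metr n M} {a b : EReal} (hg : IsRicciFlow g a b) {x : M}
    {C : ℝ} (hC : ∀ t ∈ timeInterval a b, rmNorm (g t) x ≤ C) {s t : ℝ}
    (hs : s ∈ timeInterval a b) (ht : t ∈ timeInterval a b) (v : Eu n) :
    innerAt (g t) x v v ≤ Real.exp (2 * n ^ 3 * C * |t - s|) * innerAt (g s) x v v :=
  le_exp_mul_of_abs_deriv_le (convex_timeInterval a b) (u := fun t => innerAt (g t) x v v)
    (fun t ht => hg.flow t ht x v v)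
    (fun t ht => by
      rw [abs_mul, abs_neg, abs_two, mul_assoc 2, mul_assoc 2]
      exact mul_le_mul_of_nonneg_left (hg.abs_ricci_le ht (hC t ht) v) zero_le_two) hs ht

end FlowComparison

/-! ### Distances under locally uniform convergence -/

lemma tendstoUniformlyOn_of_iteratedFDeriv_zero {E F : Type*} [NormedAddCommGroup E]
    [NormedSpace ℝ E] [NormedAddCommGroup F] [NormedSpace ℝ F] {f : ℕ → E → F} {f₀ : E → F}
    {K : Set E} (h : TendstoUniformlyOn (fun i => iteratedFDeriv ℝ 0 (f i))
      (iteratedFDeriv ℝ 0 f₀) atTop K) : TendstoUniformlyOn f f₀ atTop K := by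
  simp only [Metric.tendstoUniformlyOn_iff, iteratedFDeriv_zero_eq_comp, Function.comp_apply,
    LinearIsometryEquiv.dist_map] at h ⊢
  exact h

lemma _root_.Filter.Tendsto.bilin_apply {E : Type*} [NormedAddCommGroup E] [NormedSpace ℝ E]
    {ι : Type*} {l : Filter ι} {F : ι → E →L[ℝ] E →L[ℝ] ℝ} {B : E →L[ℝ] E →L[ℝ] ℝ}
    (hF : Tendsto F l (𝓝 B)) (v w : E) : Tendsto (fun i => F i v w) l (𝓝 (B v w)) := by
  have h : Continuous fun B : E →L[ℝ] E →L[ℝ] ℝ => B v w := by fun_prop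
  exact (h.tendsto B).comp hF

lemma tendsto_of_tendstoUniformlyOn_singleton {X Y W : Type*} [UniformSpace W]
    {f : ℕ → X → Y → W} {f₀ : X → Y → W} {x : X} {y : Y}
    (h : TendstoUniformlyOn (fun i (z : X × Y) => f i z.1 z.2) (fun z : X × Y => f₀ z.1 z.2) atTop
      {(x, y)}) : Tendsto (fun i => f i x y) atTop (𝓝 (f₀ x y)) :=
  h.tendsto_at (mem_singleton _)

section Segment

variable {n : ℕ} {N : Type*} [TopologicalSpace N] [ChartedSpace (Eu n) N]
  [IsManifold (𝓡 n) ∞ N]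

/-- The image of a straight segment under `f` bounds the distance of the images of its endpoints in
terms of the pullback metric. -/
lemma gdist_le_of_norm_pullMetric_le (g : Metr n N) {f : Eu n → N} {U : Set (Eu n)}
    (hU : IsOpen U) (hconv : Convex ℝ U) (hf : ContMDiffOn (𝓡 n) (𝓡 n) 1 f U) {L : ℝ}
    (hL : ∀ y ∈ U, ‖pullMetric g f y‖ ≤ L) {y z : Eu n} (hy : y ∈ U) (hz : z ∈ U) :
    gdist g (f y) (f z) ≤ ENNReal.ofReal √(L * ‖z - y‖ * ‖z - y‖) := by
  let c : ℝ → Eu n := fun s => y + s • (z - y)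
  have hcU : ∀ s ∈ Icc (0 : ℝ) 1, c s ∈ U := fun s hs => by
    exact hconv.add_smul_sub_mem hy hz hs
  have hc : ∀ s, HasDerivAt c (z - y) s := fun s => by
    have := ((hasDerivAt_id s).smul_const (z - y)).const_add y
    rw [one_smul] at this
    exact this
  have hcs : ContMDiff 𝓘(ℝ, ℝ) (𝓡 n) 1 c := by
    rw [contMDiff_iff_contDiff]
    fun_prop
  have hlen := gdist_le_pathLength g (γ := f ∘ c) zero_le_one (hf.comp hcs.contMDiffOn hcU)
  have e0 : (f ∘ c) 0 = f y := by simp [c]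
  have e1 : (f ∘ c) 1 = f z := by simp [c]
  rw [e0, e1] at hlen
  refine hlen.trans ?_
  have hvel : ∀ s ∈ Icc (0 : ℝ) 1, velocity (f ∘ c) s
      = (mfderiv (𝓡 n) (𝓡 n) f (c s) : Eu n →L[ℝ] Eu n) (z - y) := by
    intro s hs
    have hfs : MDifferentiableAt (𝓡 n) (𝓡 n) f (c s) :=
      (hf.contMDiffAt (hU.mem_nhds (hcU s hs))).mdifferentiableAt one_ne_zero
    have hcs' : MDifferentiableAt 𝓘(ℝ, ℝ) (𝓡 n) c s := hcs.mdifferentiableAt one_ne_zero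
    rw [velocity, mfderiv_comp s hfs hcs']
    have : (mfderiv 𝓘(ℝ, ℝ) (𝓡 n) c s : ℝ →L[ℝ] Eu n) (1 : ℝ) = z - y := by
      rw [mfderiv_eq_fderiv]
      exact (hc s).deriv
    exact congrArg (mfderiv (𝓡 n) (𝓡 n) f (c s) : Eu n →L[ℝ] Eu n) this
  have hbound : ∀ s ∈ Icc (0 : ℝ) 1, ENNReal.ofReal √(innerAt g ((f ∘ c) s)
      (velocity (f ∘ c) s) (velocity (f ∘ c) s)) ≤ ENNReal.ofReal √(L * ‖z - y‖ * ‖z - y‖) := by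
    intro s hs
    refine ENNReal.ofReal_le_ofReal (Real.sqrt_le_sqrt ?_)
    rw [hvel s hs]
    change pullMetric g f (c s) (z - y) (z - y) ≤ _
    refine (Real.le_norm_self _).trans ((ContinuousLinearMap.le_opNorm₂ _ _ _).trans ?_)
    gcongr
    exact hL _ (hcU s hs)
  calc pathLength g (f ∘ c) 0 1
      ≤ ∫⁻ _ in Icc (0 : ℝ) 1, ENNReal.ofReal √(L * ‖z - y‖ * ‖z - y‖) :=
        MeasureTheory.setLIntegral_mono measurable_const hbound
    _ = _ := by simp

end Segment

section Limit

variable {n : ℕ} {N : ℕ → Type*} [∀ i, TopologicalSpace (N i)] [∀ i, ChartedSpace (Eu n) (N i)]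
  [∀ i, IsManifold (𝓡 n) ∞ (N i)] {M : Type*} [TopologicalSpace M] [ChartedSpace (Eu n) M]
  [IsManifold (𝓡 n) ∞ M] {g : ∀ i, ℝ → Metr n (N i)} {h : ℝ → Metr n M} {a b : EReal}
  {Ω : ℕ → Set M} {φ : ∀ i, M → N i}

/-- Under locally uniform convergence of the pulled back metrics, the images of a neighbourhood of
a point have bounded diameter. -/
lemma exists_nhds_gdist_le {t : ℝ} (ht : t ∈ timeInterval a b) (hh : IsRicciFlow h a b)
    (hΩ : ∀ K : Set M, IsCompact K → ∀ᶠ i in atTop, K ⊆ Ω i)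
    (hφ : ∀ i, IsDiffeoOntoImage (n := n) (φ i) (Ω i))
    (hconv : ∀ (x₀ : M) (K : Set (ℝ × Eu n)), IsCompact K →
      K ⊆ timeInterval a b ×ˢ (extChartAt (𝓡 n) x₀).target →
      TendstoUniformlyOn (fun i => fun z : ℝ × Eu n =>
          pullMetric (g i z.1) (φ i ∘ (extChartAt (𝓡 n) x₀).symm) z.2)
        (fun z : ℝ × Eu n => coordMetric (h z.1) x₀ z.2) atTop K) (x₀ : M) :
    ∃ U ∈ 𝓝 x₀, ∃ R : ℝ≥0∞, R ≠ ⊤ ∧ ∀ᶠ i in atTop, ∀ x ∈ U,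
      gdist (g i t) (φ i x₀) (φ i x) ≤ R := by
  set ψ := extChartAt (𝓡 n) x₀ with hψ
  obtain ⟨ε, hε, hball⟩ := Metric.nhds_basis_closedBall.mem_iff.1
    (extChartAt_target_mem_nhds (I := 𝓡 n) x₀)
  have hB : IsCompact (Metric.closedBall (ψ x₀) ε) := isCompact_closedBall _ _
  have hsub : ({t} : Set ℝ) ×ˢ Metric.closedBall (ψ x₀) ε ⊆ timeInterval a b ×ˢ ψ.target :=
    prod_mono (by simpa using ht) hball
  obtain ⟨L, hL⟩ := hB.exists_bound_of_continuousOn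
    ((hh.contDiffOn_coordMetric ht x₀).continuousOn.mono hball)
  have hunif := Metric.tendstoUniformlyOn_iff.1
    (hconv x₀ _ (isCompact_singleton.prod hB) hsub) 1 one_pos
  have hcomp : IsCompact (ψ.symm '' Metric.closedBall (ψ x₀) ε) :=
    hB.image_of_continuousOn ((continuousOn_extChartAt_symm x₀).mono hball)
  refine ⟨ψ.source ∩ ψ ⁻¹' Metric.ball (ψ x₀) ε, ?_,
    ENNReal.ofReal √((L + 1) * ε * ε), ENNReal.ofReal_ne_top, ?_⟩
  · exact inter_mem (extChartAt_source_mem_nhds x₀)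
      ((continuousAt_extChartAt x₀).preimage_mem_nhds (Metric.ball_mem_nhds _ hε))
  filter_upwards [hunif, hΩ _ hcomp] with i hi hΩi x hx
  -- the limit metric is bounded by `L` and the pulled back metrics are within `1` of it
  have hbound : ∀ y ∈ Metric.ball (ψ x₀) ε, ‖pullMetric (g i t) (φ i ∘ ψ.symm) y‖ ≤ L + 1 := by
    intro y hy
    have hy' := Metric.ball_subset_closedBall hy
    have h1 := hi (t, y) ⟨rfl, hy'⟩
    have h2 := hL y hy'
    rw [dist_comm, dist_eq_norm] at h1
    have h3 := norm_le_norm_add_norm_sub' (pullMetric (g i t) (φ i ∘ ψ.symm) y)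
      (coordMetric (h t) x₀ y)
    linarith
  have hsm : ContMDiffOn (𝓡 n) (𝓡 n) 1 (φ i ∘ ψ.symm) (Metric.ball (ψ x₀) ε) :=
    ((hφ i).1.comp ((contMDiffOn_extChartAt_symm x₀).mono
      (Metric.ball_subset_closedBall.trans hball)) fun y hy =>
        hΩi (mem_image_of_mem _ (Metric.ball_subset_closedBall hy))).of_le (by simp)
  have hd := gdist_le_of_norm_pullMetric_le (g i t) Metric.isOpen_ball (convex_ball _ _) hsm
    hbound (Metric.mem_ball_self hε) hx.2
  have e0 : (φ i ∘ ψ.symm) (ψ x₀) = φ i x₀ := by simp [hψ]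
  have e1 : (φ i ∘ ψ.symm) (ψ x) = φ i x := by simp [ψ.left_inv hx.1]
  rw [e0, e1] at hd
  refine hd.trans (ENNReal.ofReal_le_ofReal (Real.sqrt_le_sqrt ?_))
  have h0 : 0 ≤ L + 1 :=
    (norm_nonneg _).trans (hbound _ (Metric.mem_ball_self hε))
  have h1 : ‖ψ x - ψ x₀‖ ≤ ε := by
    rw [← dist_eq_norm]
    exact (Metric.mem_ball.1 hx.2).le
  gcongr

omit [ChartedSpace (Eu n) M] [IsManifold (𝓡 n) ∞ M] in
/-- In a connected space, if the distances of the images of nearby points are eventually bounded,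
then so are the distances of the images of any two points. -/
lemma exists_gdist_le_of_connected [PreconnectedSpace M] {t : ℝ}
    (hloc : ∀ x₀ : M, ∃ U ∈ 𝓝 x₀, ∃ R : ℝ≥0∞, R ≠ ⊤ ∧ ∀ᶠ i in atTop, ∀ x ∈ U,
      gdist (g i t) (φ i x₀) (φ i x) ≤ R) (q x : M) :
    ∃ R : ℝ≥0∞, R ≠ ⊤ ∧ ∀ᶠ i in atTop, gdist (g i t) (φ i q) (φ i x) ≤ R := by
  let S : Set M := {x | ∃ R : ℝ≥0∞, R ≠ ⊤ ∧ ∀ᶠ i in atTop, gdist (g i t) (φ i q) (φ i x) ≤ R}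
  have hopen : IsOpen S := by
    refine isOpen_iff_mem_nhds.2 fun x₀ ⟨R, hR, hx₀⟩ => ?_
    obtain ⟨U, hU, R', hR', hUR⟩ := hloc x₀
    filter_upwards [hU] with x hx
    refine ⟨R + R', ENNReal.add_ne_top.2 ⟨hR, hR'⟩, ?_⟩
    filter_upwards [hx₀, hUR] with i h1 h2
    exact (gdist_triangle _ _ _ _).trans (add_le_add h1 (h2 x hx))
  have hclosed : IsClosed S := by
    refine ⟨isOpen_iff_mem_nhds.2 fun x₀ hx₀ => ?_⟩
    obtain ⟨U, hU, R', hR', hUR⟩ := hloc x₀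
    filter_upwards [hU] with x hx
    rintro ⟨R, hR, hRx⟩
    refine hx₀ ⟨R + R', ENNReal.add_ne_top.2 ⟨hR, hR'⟩, ?_⟩
    filter_upwards [hRx, hUR] with i h1 h2
    refine (gdist_triangle _ _ (φ i x) _).trans (add_le_add h1 ?_)
    rw [gdist_comm]
    exact h2 x hx
  have hq : q ∈ S := ⟨0, ENNReal.zero_ne_top, Eventually.of_forall fun i => (gdist_self _ _).le⟩
  have : S = univ := IsClopen.eq_univ ⟨hclosed, hopen⟩ ⟨q, hq⟩
  have hx : x ∈ S := by rw [this]; exact mem_univ x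
  exact hx

/-! ### Passage to the limit -/

/-- A comparison of the metrics at two times passes to the limit. -/
lemma innerAt_le_of_tendsto {s t : ℝ} {x : M} {c : ℝ}
    (hlim : ∀ τ ∈ ({s, t} : Set ℝ), Tendsto
      (fun i => pullMetric (g i τ) (φ i ∘ (extChartAt (𝓡 n) x).symm) (extChartAt (𝓡 n) x x))
      atTop (𝓝 (coordMetric (h τ) x (extChartAt (𝓡 n) x x))))
    (hc : ∀ᶠ i in atTop, ∀ v, innerAt (g i t) (φ i x) v v ≤ c * innerAt (g i s) (φ i x) v v)
    (v : Eu n) : innerAt (h t) x v v ≤ c * innerAt (h s) x v v := by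
  have happ : ∀ τ ∈ ({s, t} : Set ℝ), Tendsto (fun i => pullMetric (g i τ)
      (φ i ∘ (extChartAt (𝓡 n) x).symm) (extChartAt (𝓡 n) x x) v v) atTop
      (𝓝 (innerAt (h τ) x v v)) := fun τ hτ => by
    have := hlim τ hτ
    rw [coordMetric_self] at this
    exact this.bilin_apply v v
  refine le_of_tendsto_of_tendsto (happ t (by simp)) ((happ s (by simp)).const_mul c) ?_
  filter_upwards [hc] with i hi
  have hx : (φ i ∘ (extChartAt (𝓡 n) x).symm) (extChartAt (𝓡 n) x x) = φ i x := by simp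
  change innerAt (g i t) ((φ i ∘ (extChartAt (𝓡 n) x).symm) (extChartAt (𝓡 n) x x)) _ _
    ≤ c * innerAt (g i s) ((φ i ∘ (extChartAt (𝓡 n) x).symm) (extChartAt (𝓡 n) x x)) _ _
  rw [hx]
  exact hi _

/-- If the curvatures of the flows `g i` are bounded by the same constant on all balls about the
base points, for large `i`, then the metrics of a limit flow are complete. -/
theorem IsLimitFlow.isCompleteMetric [ConnectedSpace M] {p : ∀ i, N i} {q : M} (ha : a < 0)
    (hb : 0 < b) (hflow : ∀ i, IsRicciFlow (g i) a b) {C : ℝ}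
    (hC : ∀ r : ℝ, 0 < r → ∃ K : ℕ, ∀ t ∈ timeInterval a b, ∀ i ≥ K,
      ∀ x ∈ gball (g i 0) (p i) r, rmNorm (g i t) x ≤ C)
    (hlim : IsLimitFlow g p h q a b) :
    ∀ t ∈ timeInterval a b, IsCompleteMetric (h t) := by
  obtain ⟨σ, hσ, Ω, φ, -, hΩ, -, hφ, hφq, hconv⟩ := hlim.converges
  have h0 : (0 : ℝ) ∈ timeInterval a b := ⟨by simpa using ha, by simpa using hb⟩
  have hconv0 : ∀ (x₀ : M) (K : Set (ℝ × Eu n)), IsCompact K →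
      K ⊆ timeInterval a b ×ˢ (extChartAt (𝓡 n) x₀).target →
      TendstoUniformlyOn (fun i => fun z : ℝ × Eu n =>
          pullMetric (g (σ i) z.1) (φ i ∘ (extChartAt (𝓡 n) x₀).symm) z.2)
        (fun z : ℝ × Eu n => coordMetric (h z.1) x₀ z.2) atTop K := fun x₀ K hK hK' =>
    tendstoUniformlyOn_of_iteratedFDeriv_zero (hconv x₀ 0 K hK hK')
  have hpt : ∀ τ ∈ timeInterval a b, ∀ x : M, Tendsto (fun i => pullMetric (g (σ i) τ)
      (φ i ∘ (extChartAt (𝓡 n) x).symm) (extChartAt (𝓡 n) x x)) atTop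
      (𝓝 (coordMetric (h τ) x (extChartAt (𝓡 n) x x))) := fun τ hτ x =>
    tendsto_of_tendstoUniformlyOn_singleton
      (f := fun i t y => pullMetric (g (σ i) t) (φ i ∘ (extChartAt (𝓡 n) x).symm) y)
      (f₀ := fun t y => coordMetric (h t) x y)
      (hconv0 x {(τ, extChartAt (𝓡 n) x x)} isCompact_singleton
        (singleton_subset_iff.2 ⟨hτ, mem_extChartAt_target x⟩))
  -- each point of the limit is mapped into a fixed ball about the base point, where the curvature
  -- bound applies, for all large `i`
  have hrm : ∀ x : M, ∀ᶠ i in atTop, ∀ t ∈ timeInterval a b, rmNorm (g (σ i) t) (φ i x) ≤ C := by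
    intro x
    obtain ⟨R, hR, hRx⟩ := exists_gdist_le_of_connected (g := fun i => g (σ i))
      (exists_nhds_gdist_le h0 hlim.ricciFlow hΩ hφ hconv0) q x
    obtain ⟨K, hK⟩ := hC (R.toReal + 1) (by positivity)
    filter_upwards [hRx, hσ.tendsto_atTop.eventually_ge_atTop K] with i hi hKi t ht
    refine hK t ht _ hKi _ ?_
    have hp : p (σ i) = φ i q := (hφq i).symm
    rw [gball, mem_ofPred_eq, hp]
    refine hi.trans_lt ?_
    rw [← ENNReal.ofReal_toReal hR]
    exact (ENNReal.ofReal_lt_ofReal_iff (by positivity)).2 (by simp)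
  have hcomp : ∀ s ∈ timeInterval a b, ∀ t ∈ timeInterval a b, ∀ (x : M) (v : Eu n),
      innerAt (h t) x v v ≤ Real.exp (2 * n ^ 3 * C * |t - s|) * innerAt (h s) x v v := by
    intro s hs t ht x v
    refine innerAt_le_of_tendsto (g := fun i => g (σ i)) (φ := φ) ?_ ?_ v
    · rintro τ (rfl | rfl)
      exacts [hpt _ hs x, hpt _ ht x]
    · filter_upwards [hrm x] with i hi v
      exact (hflow (σ i)).innerAt_le hi hs ht v
  intro t ht
  refine hlim.complete_zero.of_comparable (Real.exp_pos (n ^ 3 * C * |t|)) ?_ ?_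
  · intro x v
    rw [← Real.exp_nat_mul]
    convert hcomp t ht 0 h0 x v using 3
    rw [zero_sub, abs_neg]
    push_cast
    ring
  · intro x v
    rw [← Real.exp_nat_mul]
    convert hcomp 0 h0 t ht x v using 3
    rw [sub_zero]
    push_cast
    ring

end Limit

end RicciLimit
end

theorem theorem1p6 {n : ℕ} {a b : EReal} (ha : a < 0) (hb : 0 < b)
    -- the sequence of complete pointed Ricci flows
    (N : ℕ → Type*) [∀ i, TopologicalSpace (N i)] [∀ i, ChartedSpace (RicciLimit.Eu n) (N i)]
    [∀ i, IsManifold (𝓡 n) ∞ (N i)] [∀ i, T2Space (N i)] [∀ i, SecondCountableTopology (N i)]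
    (g : ∀ i, ℝ → RicciLimit.Metr n (N i)) (p : ∀ i, N i)
    (hflow : ∀ i, RicciLimit.IsRicciFlow (g i) a b)
    (hcomplete : ∀ i, ∀ t ∈ RicciLimit.timeInterval a b, RicciLimit.IsCompleteMetric (g i t))
    -- the curvature bound, with `C` independent of `r`
    (hcurv : ∃ C : ℝ, ∀ r : ℝ, 0 < r → ∃ K : ℕ, ∀ t ∈ RicciLimit.timeInterval a b, ∀ i ≥ K,
      ∀ x ∈ RicciLimit.gball (g i 0) (p i) r, RicciLimit.rmNorm (g i t) x ≤ C)
    -- the injectivity radius bound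
    (hinj : 0 < ⨅ i, RicciLimit.injRadius (g i 0) (p i))
    -- the resulting limit flow
    (M : Type*) [TopologicalSpace M] [ChartedSpace (RicciLimit.Eu n) M]
    [IsManifold (𝓡 n) ∞ M] [T2Space M] [SecondCountableTopology M] [ConnectedSpace M]
    (h : ℝ → RicciLimit.Metr n M) (q : M)
    (hlim : RicciLimit.IsLimitFlow g p h q a b) :
    ∀ t ∈ RicciLimit.timeInterval a b, RicciLimit.IsCompleteMetric (h t) := by
  obtain ⟨C, hC⟩ := hcurv
  exact hlim.isCompleteMetric ha hb hflow hC
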